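/- Let $\Lambda=\mathbb C[x_{ki}\mid 1\le i\le k\le n]$, $L=\operatorname{Frac}\Lambda$, and let $\mathscr M\subset\operatorname{Aut}(\Lambda)$ be the group generated by the shifts $\delta^{ki}$ ($1\le i\le k\le n-1$), where $\delta^{ki}$ sends $x_{ki}$ to $x_{ki}-1$ and fixes all other variables. Let $\mathscr L=L\#\mathscr M$ be the skew monoid ring, with $(a\mu)(b\nu)=a\,\mu(b)\,\mu\nu$. The group $\mathbb S_n=S_1\times\cdots\times S_n$ acts on $\Lambda$ and $L$ by permuting, for each $k$, the variables $x_{k1},\dots,x_{kk}$, and on $\mathscr L$ by $g(a\mu)=g(a)\,(g\mu g^{-1})$; let $\mathbb A_n=A_1\times\cdots\times A_n$ be the product of the alternating groups. Put $\Gamma=\Lambda^{\mathbb S_n}$, $K=L^{\mathbb S_n}$, $\widetilde\Gamma=\Lambda^{\mathbb A_n}$, $\widetilde K=L^{\mathbb A_n}$, $\widetilde{\mathscr K}=\mathscr L^{\mathbb A_n}$. Let $U_n\subset\mathscr L$ be the image of $U(\mathfrak{gl}_n)$, that is, the $\mathbb C$-subalgebra generated by $$X_k^{\pm}=\sum_{i=1}^k(\delta^{ki})^{\pm1}a_{ki}^{\pm}\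 (1\le k\le n-1),\qquad X_{kk}=\sum_{j=1}^k(x_{kj}+j-1)-\sum_{i=1}^{k-1}(x_{k-1,i}+i-1)\ (1\le k\le n),$$ the images of $E_{k,k+1}$, $E_{k+1,k}$ and $E_{kk}$, where $$a_{ki}^\pm=\mp\frac{\prod_{j=1}^{k\pm1}(x_{k\pm1,j}-x_{ki})}{\prod_{j\ne i}(x_{kj}-x_{ki})}.$$ Let $\mathscr A(\mathfrak{gl}_n)$ be the subalgebra of $\mathscr L$ generated by $U_n$ and $\mathcal V_\ell=\prod_{i<j}(x_{\ell i}-x_{\ell j})$, $2\le\ell\le n$. A subring $U$ with $\widetilde\Gamma\subseteq U\subseteq\widetilde{\mathscr K}$ is a *Galois $\widetilde\Gamma$-ring* if it is finitely generated as a ring over $\widetilde\Gamma$ and $\widetilde KU=U\widetilde K=\widetilde{\mathscr K}$. It is a *Galois $\widetilde\Gamma$-order* if moreover, for every finite-dimensional left (respectively right) $\widetilde K$-subspace $W\subseteq\widetilde{\mathscr K}$, $W\cap U$ is a finitely generated left (respectively right) $\widetilde\Gamma$-module. **Proposition.** 1. For every $n\ge3$, $U_n\subsetneq\mathscr A(\mathfrak{gl}_n)^{\mathbb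 S_n}$. 2. For $n=3$, the rational function $$f=\frac{\prod_{i=1}^3(x_{3i}-x_{21}+1)}{x_{22}-x_{21}+1}\cdot\frac{x_{11}-x_{21}}{x_{22}-x_{21}}\cdot\frac{\prod_{i=1}^3(x_{3i}-x_{22}+1)}{x_{21}-x_{22}+1}\cdot\frac{x_{11}-x_{22}}{x_{21}-x_{22}}$$ lies in $\mathscr A(\mathfrak{gl}_3)^{\mathbb S_3}\cap K$; it is not a polynomial, that is, $f\notin\Lambda$, and so $f\notin\Gamma$. 3. For every $n\ge3$, $\mathscr A(\mathfrak{gl}_n)$ is not a Galois $\widetilde\Gamma$-order. -/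

import Mathlib

namespace AltExt

noncomputable section

/-! ### Polynomials, rational functions and shift automorphisms -/

/-- The pairs `(k, i)` with `1 ≤ i ≤ k ≤ n`, indexing the variables `x_{ki}`. -/
abbrev Idx (n : ℕ) : Type := Σ k : Finset.Icc 1 n, Finset.Icc 1 (k : ℕ)

/-- `Λ = ℂ[x_{ki} | 1 ≤ i ≤ k ≤ n]`. -/
abbrev Lam (n : ℕ) : Type := MvPolynomial (Idx n) ℂ

/-- `L = Frac Λ`. -/
abbrev Frac (n : ℕ) : Type := FractionRing (Lam n)

/-- The pair `(k, i)` as an element of `Idx n`. -/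
def mkIdx (n k i : ℕ) (h : 1 ≤ i ∧ i ≤ k ∧ k ≤ n) : Idx n :=
  ⟨⟨k, Finset.mem_Icc.2 ⟨h.1.trans h.2.1, h.2.2⟩⟩, ⟨i, Finset.mem_Icc.2 ⟨h.1, h.2.1⟩⟩⟩

/-- The indeterminate `x_{ki}` as an element of `L`, for `1 ≤ i ≤ k ≤ n`
(the value `0` outside this range is never used). -/
def x (n k i : ℕ) : Frac n :=
  if h : 1 ≤ i ∧ i ≤ k ∧ k ≤ n then
    algebraMap (Lam n) (Frac n) (MvPolynomial.X (mkIdx n k i h))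
  else 0

/-- The endomorphism of `Λ` adding the constant `c` to the variable with index `p`. -/
def shiftHom {n : ℕ} (p : Idx n) (c : ℂ) : Lam n →ₐ[ℂ] Lam n :=
  MvPolynomial.aeval fun q =>
    MvPolynomial.X q + MvPolynomial.C (if q = p then c else 0)

lemma shiftHom_comp {n : ℕ} (p : Idx n) (c d : ℂ) (h : c + d = 0) :
    (shiftHom p c).comp (shiftHom p d) = AlgHom.id ℂ (Lam n) := by
  apply MvPolynomial.algHom_ext
  intro q
  by_cases hq : q = p
  · subst hq
    simp [shiftHom, add_assoc, ← MvPolynomial.C_add, h]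
  · simp [shiftHom, hq]

/-- The automorphism `δ^{ki}` of `Λ`, `δ^{ki}(x_{ℓj}) = x_{ℓj} - δ_{ℓk} δ_{ij}`,
for the index `p = (k, i)`. -/
def delta {n : ℕ} (p : Idx n) : Lam n ≃ₐ[ℂ] Lam n :=
  AlgEquiv.ofAlgHom (shiftHom p (-1)) (shiftHom p 1)
    (shiftHom_comp p _ _ (by ring)) (shiftHom_comp p _ _ (by ring))

lemma delta_X {n : ℕ} (p q : Idx n) :
    delta p (MvPolynomial.X q) = MvPolynomial.X q - (if q = p then 1 else 0) := by
  change shiftHom p (-1) (MvPolynomial.X q) = _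
  by_cases h : q = p <;> simp [shiftHom, h, sub_eq_add_neg]

/-- `ℳ`: the subgroup of `Aut(Λ)` generated by the `δ^{ki}`, `1 ≤ i ≤ k ≤ n - 1`. -/
def shifts (n : ℕ) : Subgroup (Lam n ≃ₐ[ℂ] Lam n) :=
  Subgroup.closure {τ | ∃ p : Idx n, (p.1 : ℕ) < n ∧ τ = delta p}

/-- The extension of automorphisms from `Λ` to `L`. -/
def extAut (n : ℕ) : (Lam n ≃ₐ[ℂ] Lam n) →* (Frac n ≃ₐ[ℂ] Frac n) :=
  IsFractionRing.fieldEquivOfAlgEquivHom ℂ (Frac n)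

lemma extAut_algebraMap {n : ℕ} (σ : Lam n ≃ₐ[ℂ] Lam n) (f : Lam n) :
    extAut n σ (algebraMap (Lam n) (Frac n) f) = algebraMap (Lam n) (Frac n) (σ f) :=
  IsFractionRing.fieldEquivOfAlgEquiv_algebraMap ℂ (Frac n) (Frac n) σ f

instance actShifts (n : ℕ) : MulSemiringAction (shifts n) (Frac n) :=
  MulSemiringAction.compHom (Frac n) ((extAut n).comp (shifts n).subtype)

lemma shifts_smul_def {n : ℕ} (μ : shifts n) (a : Frac n) :
    μ • a = extAut n (μ : Lam n ≃ₐ[ℂ] Lam n) a := rfl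

instance commShifts (n : ℕ) : SMulCommClass (shifts n) ℂ (Frac n) where
  smul_comm μ c a := by
    rw [Algebra.smul_def, Algebra.smul_def, smul_mul', shifts_smul_def, AlgEquiv.commutes]

/-- `ℒ = L # ℳ`, the skew monoid ring: the free left `L`-module on `ℳ`
with `(a₁ μ₁)(a₂ μ₂) = (a₁ μ₁(a₂)) (μ₁ μ₂)`. -/
abbrev SkewRing (n : ℕ) : Type := SkewMonoidAlgebra (Frac n) (shifts n)

/-- The embedding `L → ℒ`, `a ↦ a · 1`. -/
def ofFrac (n : ℕ) : Frac n →ₐ[ℂ] SkewRing n where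
  toRingHom := SkewMonoidAlgebra.singleOneRingHom
  commutes' _ := rfl

/-- `δ^{ki}` as an element of `ℳ`, for `1 ≤ i ≤ k ≤ n - 1`
(the value `1` outside this range is never used). -/
def dl (n k i : ℕ) : shifts n :=
  if h : (1 ≤ i ∧ i ≤ k ∧ k ≤ n) ∧ k < n then
    ⟨delta (mkIdx n k i h.1), Subgroup.subset_closure ⟨_, h.2, rfl⟩⟩
  else 1

/-- The inclusion `ℳ → ℒ`, `μ ↦ 1 · μ`. -/
def ofShift (n : ℕ) : shifts n →* SkewRing n := SkewMonoidAlgebra.of (Frac n) (shifts n)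

/-! ### Symmetric and alternating groups acting on `Λ`, `L` and `ℒ` -/

/-- `𝕊_n = S_1 × S_2 × ⋯ × S_n`. -/
abbrev SymProd (n : ℕ) : Type := ∀ k : Finset.Icc 1 n, Equiv.Perm (Finset.Icc 1 (k : ℕ))

/-- `𝔸_n = A_1 × A_2 × ⋯ × A_n` as a subgroup of `𝕊_n`. -/
def altProd (n : ℕ) : Subgroup (SymProd n) :=
  Subgroup.pi Set.univ fun k => alternatingGroup (Finset.Icc 1 (k : ℕ))

/-- The permutation `(k, i) ↦ (k, g_k(i))` of the indices. -/
def permIdx {n : ℕ} (g : SymProd n) : Equiv.Perm (Idx n) := Equiv.sigmaCongrRight g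

/-- The action of `𝕊_n` on `Λ`: `g(x_{ki}) = x_{k, g_k(i)}`. -/
def symLam (n : ℕ) : SymProd n →* (Lam n ≃ₐ[ℂ] Lam n) where
  toFun g := MvPolynomial.renameEquiv ℂ (permIdx g)
  map_one' := by
    apply AlgEquiv.ext
    intro f
    change MvPolynomial.rename (permIdx (1 : SymProd n)) f = f
    have : (permIdx (1 : SymProd n) : Idx n → Idx n) = id := rfl
    rw [this, MvPolynomial.rename_id_apply]
  map_mul' g h := by
    apply AlgEquiv.ext
    intro f
    change MvPolynomial.rename (permIdx (g * h)) f =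
      MvPolynomial.rename (permIdx g) (MvPolynomial.rename (permIdx h) f)
    rw [MvPolynomial.rename_rename]
    rfl

lemma symLam_X {n : ℕ} (g : SymProd n) (p : Idx n) :
    symLam n g (MvPolynomial.X p) = MvPolynomial.X (permIdx g p) :=
  MvPolynomial.rename_X _ _

/-- The action of `𝕊_n` on `L`. -/
def symFrac (n : ℕ) : SymProd n →* (Frac n ≃ₐ[ℂ] Frac n) := (extAut n).comp (symLam n)

lemma conj_delta {n : ℕ} (g : SymProd n) (p : Idx n) :
    symLam n g * delta p * (symLam n g)⁻¹ = delta (permIdx g p) := by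
  rw [mul_inv_eq_iff_eq_mul]
  have : ((symLam n g * delta p : Lam n ≃ₐ[ℂ] Lam n) : Lam n →ₐ[ℂ] Lam n) =
      ((delta (permIdx g p) * symLam n g : Lam n ≃ₐ[ℂ] Lam n) : Lam n →ₐ[ℂ] Lam n) := by
    apply MvPolynomial.algHom_ext
    intro q
    change symLam n g (delta p (MvPolynomial.X q)) =
      delta (permIdx g p) (symLam n g (MvPolynomial.X q))
    rw [delta_X, symLam_X, delta_X, map_sub, symLam_X]
    by_cases h : q = p <;> simp [h]
  exact AlgEquiv.ext fun f => DFunLike.congr_fun this f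

lemma conj_mem {n : ℕ} (g : SymProd n) {μ : Lam n ≃ₐ[ℂ] Lam n} (hμ : μ ∈ shifts n) :
    symLam n g * μ * (symLam n g)⁻¹ ∈ shifts n := by
  have hle : shifts n ≤ (shifts n).comap (MulAut.conj (symLam n g)).toMonoidHom := by
    unfold shifts
    rw [Subgroup.closure_le]
    rintro _ ⟨p, hp, rfl⟩
    change symLam n g * delta p * (symLam n g)⁻¹ ∈ shifts n
    rw [conj_delta]
    exact Subgroup.subset_closure (k := {τ | ∃ p : Idx n, (p.1 : ℕ) < n ∧ τ = delta p})
      ⟨permIdx g p, hp, rfl⟩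
  exact hle hμ

/-- The action of `𝕊_n` on `ℳ` by conjugation, `μ ↦ g ∘ μ ∘ g⁻¹`. -/
def conjShift {n : ℕ} (g : SymProd n) : shifts n →* shifts n :=
  ((MulAut.conj (symLam n g)).toMonoidHom.comp (shifts n).subtype).codRestrict (shifts n)
    fun μ => conj_mem g μ.2

lemma conjShift_coe {n : ℕ} (g : SymProd n) (μ : shifts n) :
    (conjShift g μ : Lam n ≃ₐ[ℂ] Lam n) = symLam n g * μ * (symLam n g)⁻¹ := rfl

lemma symFrac_smul {n : ℕ} (g : SymProd n) (μ : shifts n) (a : Frac n) :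
    symFrac n g (μ • a) = conjShift g μ • symFrac n g a := by
  rw [shifts_smul_def, shifts_smul_def, conjShift_coe]
  change (extAut n (symLam n g) * extAut n μ) a =
    (extAut n (symLam n g * μ * (symLam n g)⁻¹) * extAut n (symLam n g)) a
  rw [← map_mul, ← map_mul]
  simp

/-- The action of `𝕊_n` on `ℒ`: `g(a μ) = g(a) (g ∘ μ ∘ g⁻¹)`. -/
def symSkew {n : ℕ} (g : SymProd n) : SkewRing n →ₐ[ℂ] SkewRing n :=
  SkewMonoidAlgebra.liftNCAlgHom ((ofFrac n).comp (symFrac n g : Frac n →ₐ[ℂ] Frac n))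
    ((ofShift n).comp (conjShift g)) (by
      intro a μ
      change SkewMonoidAlgebra.single 1 (symFrac n g (μ • a)) *
          SkewMonoidAlgebra.single (conjShift g μ) 1 =
        SkewMonoidAlgebra.single (conjShift g μ) 1 *
          SkewMonoidAlgebra.single 1 (symFrac n g a)
      simp [symFrac_smul])

lemma symSkew_single {n : ℕ} (g : SymProd n) (μ : shifts n) (a : Frac n) :
    symSkew g (SkewMonoidAlgebra.single μ a) =
      SkewMonoidAlgebra.single (conjShift g μ) (symFrac n g a) := by
  change SkewMonoidAlgebra.liftNC _ _ _ = _
  rw [SkewMonoidAlgebra.liftNC_single]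
  change SkewMonoidAlgebra.single 1 (symFrac n g a) *
    SkewMonoidAlgebra.single (conjShift g μ) 1 = _
  simp

/-! ### Invariants under a subgroup `H` of `𝕊_n` -/

/-- `Λ^H`, as a subalgebra of `ℒ`. For `H = 𝕊_n` this is `Γ`, for `H = 𝔸_n` it is `Γ̃`. -/
def invLam (n : ℕ) (H : Subgroup (SymProd n)) : Subalgebra ℂ (SkewRing n) :=
  (⨅ g ∈ H, AlgHom.equalizer (symLam n g : Lam n →ₐ[ℂ] Lam n) (AlgHom.id ℂ (Lam n))).map
    ((ofFrac n).comp (IsScalarTower.toAlgHom ℂ (Lam n) (Frac n)))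

/-- `L^H`, as a subalgebra of `ℒ`. For `H = 𝕊_n` this is `K`, for `H = 𝔸_n` it is `K̃`. -/
def invFrac (n : ℕ) (H : Subgroup (SymProd n)) : Subalgebra ℂ (SkewRing n) :=
  (⨅ g ∈ H, AlgHom.equalizer (symFrac n g : Frac n →ₐ[ℂ] Frac n) (AlgHom.id ℂ (Frac n))).map
    (ofFrac n)

/-- `ℒ^H`. For `H = 𝕊_n` this is `𝒦`, for `H = 𝔸_n` it is `𝒦̃`. -/
def invSkew (n : ℕ) (H : Subgroup (SymProd n)) : Subalgebra ℂ (SkewRing n) :=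
  ⨅ g ∈ H, AlgHom.equalizer (symSkew g) (AlgHom.id ℂ (SkewRing n))

lemma mem_invLam {n : ℕ} {H : Subgroup (SymProd n)} {u : SkewRing n} :
    u ∈ invLam n H ↔ ∃ f : Lam n, (∀ g ∈ H, symLam n g f = f) ∧
      ofFrac n (algebraMap (Lam n) (Frac n) f) = u := by
  simp [invLam, Algebra.mem_iInf, AlgHom.mem_equalizer]

lemma mem_invFrac {n : ℕ} {H : Subgroup (SymProd n)} {u : SkewRing n} :
    u ∈ invFrac n H ↔ ∃ a : Frac n, (∀ g ∈ H, symFrac n g a = a) ∧ ofFrac n a = u := by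
  simp [invFrac, Algebra.mem_iInf, AlgHom.mem_equalizer]

lemma mem_invSkew {n : ℕ} {H : Subgroup (SymProd n)} {u : SkewRing n} :
    u ∈ invSkew n H ↔ ∀ g ∈ H, symSkew g u = u := by
  simp [invSkew, Algebra.mem_iInf, AlgHom.mem_equalizer]

/-! ### The algebras `U_n` and `𝒜(𝔤𝔩_n)` -/

/-- `a_{ki}^+ = - ∏_{j=1}^{k+1} (x_{k+1,j} - x_{ki}) / ∏_{j≠i} (x_{kj} - x_{ki})`. -/
def aPlus (n k i : ℕ) : Frac n :=
  -((∏ j ∈ Finset.Icc 1 (k + 1), (x n (k + 1) j - x n k i)) /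
    ∏ j ∈ (Finset.Icc 1 k).erase i, (x n k j - x n k i))

/-- `a_{ki}^- = ∏_{j=1}^{k-1} (x_{k-1,j} - x_{ki}) / ∏_{j≠i} (x_{kj} - x_{ki})`. -/
def aMinus (n k i : ℕ) : Frac n :=
  (∏ j ∈ Finset.Icc 1 (k - 1), (x n (k - 1) j - x n k i)) /
    ∏ j ∈ (Finset.Icc 1 k).erase i, (x n k j - x n k i)

/-- `X_k^+ = ∑_i δ^{ki} a_{ki}^+`, the image of `E_{k,k+1}`, for `1 ≤ k ≤ n - 1`. -/
def XPlus (n k : ℕ) : SkewRing n :=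
  ∑ i ∈ Finset.Icc 1 k, ofShift n (dl n k i) * ofFrac n (aPlus n k i)

/-- `X_k^- = ∑_i (δ^{ki})⁻¹ a_{ki}^-`, the image of `E_{k+1,k}`, for `1 ≤ k ≤ n - 1`. -/
def XMinus (n k : ℕ) : SkewRing n :=
  ∑ i ∈ Finset.Icc 1 k, ofShift n (dl n k i)⁻¹ * ofFrac n (aMinus n k i)

/-- `X_{kk} = ∑_{j=1}^k (x_{kj} + j - 1) - ∑_{i=1}^{k-1} (x_{k-1,i} + i - 1)`,
the image of `E_{kk}`, for `1 ≤ k ≤ n`. -/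
def XDiag (n k : ℕ) : SkewRing n :=
  ofFrac n (∑ j ∈ Finset.Icc 1 k, (x n k j + (j : Frac n) - 1) -
    ∑ i ∈ Finset.Icc 1 (k - 1), (x n (k - 1) i + (i : Frac n) - 1))

/-- The Vandermonde polynomial `𝒱_k = ∏_{1 ≤ i < j ≤ k} (x_{ki} - x_{kj})`. -/
def vander (n k : ℕ) : SkewRing n :=
  ofFrac n (∏ i ∈ Finset.Icc 1 k, ∏ j ∈ Finset.Ioc i k, (x n k i - x n k j))

/-- The images under `φ` of the generators `E_{k,k+1}`, `E_{k+1,k}` (`1 ≤ k ≤ n - 1`)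
and `E_{kk}` (`1 ≤ k ≤ n`) of `U(𝔤𝔩_n)`. -/
def gens (n : ℕ) : Set (SkewRing n) :=
  {u | ∃ k, 1 ≤ k ∧ k < n ∧ (u = XPlus n k ∨ u = XMinus n k)} ∪
    {u | ∃ k, 1 ≤ k ∧ k ≤ n ∧ u = XDiag n k}

/-- `U_n = φ(U(𝔤𝔩_n))`: the subalgebra of `ℒ` generated by the images of the generators
of `U(𝔤𝔩_n)` (see `range_eq_Ugl`). -/
def Ugl (n : ℕ) : Subalgebra ℂ (SkewRing n) := Algebra.adjoin ℂ (gens n)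

/-- `𝒜(𝔤𝔩_n)`: the subalgebra generated by `U_n` and `𝒱_2, …, 𝒱_n`. -/
def Agl (n : ℕ) : Subalgebra ℂ (SkewRing n) :=
  Algebra.adjoin ℂ ((Ugl n : Set (SkewRing n)) ∪ {u | ∃ k, 2 ≤ k ∧ k ≤ n ∧ u = vander n k})

section

attribute [local instance 100] LieRing.ofAssociativeRing

/-- `U_n` is the image of every algebra homomorphism `φ : U(𝔤𝔩_n) → ℒ` with
`φ(E_{k,k+1}) = X_k^+`, `φ(E_{k+1,k}) = X_k^-` and `φ(E_{kk}) = X_{kk}`.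
The entry `E_{ij}` is written with indices in `{0, …, n - 1}`. -/
theorem range_eq_Ugl (n : ℕ)
    (φ : UniversalEnvelopingAlgebra ℂ (Matrix (Fin n) (Fin n) ℂ) →ₐ[ℂ] SkewRing n)
    (hplus : ∀ (k : ℕ) (h : k + 1 < n), φ (UniversalEnvelopingAlgebra.ι ℂ
      (Matrix.single ⟨k, by omega⟩ ⟨k + 1, h⟩ 1)) = XPlus n (k + 1))
    (hminus : ∀ (k : ℕ) (h : k + 1 < n), φ (UniversalEnvelopingAlgebra.ι ℂ
      (Matrix.single ⟨k + 1, h⟩ ⟨k, by omega⟩ 1)) = XMinus n (k + 1))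
    (hdiag : ∀ (k : ℕ) (h : k < n), φ (UniversalEnvelopingAlgebra.ι ℂ
      (Matrix.single ⟨k, h⟩ ⟨k, h⟩ 1)) = XDiag n (k + 1)) :
    φ.range = Ugl n := by
  have hE : ∀ i j : Fin n, φ (UniversalEnvelopingAlgebra.ι ℂ (Matrix.single i j 1)) ∈ Ugl n := by
    have hbr : ∀ i j l : Fin n, i ≠ l →
        φ (UniversalEnvelopingAlgebra.ι ℂ (Matrix.single i j 1)) ∈ Ugl n →
        φ (UniversalEnvelopingAlgebra.ι ℂ (Matrix.single j l 1)) ∈ Ugl n →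
        φ (UniversalEnvelopingAlgebra.ι ℂ (Matrix.single i l 1)) ∈ Ugl n := by
      intro i j l hil h1 h2
      have : (Matrix.single i l 1 : Matrix (Fin n) (Fin n) ℂ) =
          ⁅(Matrix.single i j 1 : Matrix (Fin n) (Fin n) ℂ),
            (Matrix.single j l 1 : Matrix (Fin n) (Fin n) ℂ)⁆ := by
        rw [Ring.lie_def, Matrix.single_mul_single_same,
          Matrix.single_mul_single_of_ne _ _ _ _ hil.symm]
        simp
      rw [this, LieHom.map_lie, Ring.lie_def, map_sub, map_mul, map_mul]
      exact sub_mem (mul_mem h1 h2) (mul_mem h2 h1)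
    have hup : ∀ (d i : ℕ) (h : i + d < n),
        φ (UniversalEnvelopingAlgebra.ι ℂ (Matrix.single ⟨i, by omega⟩ ⟨i + d, h⟩ 1)) ∈ Ugl n ∧
        φ (UniversalEnvelopingAlgebra.ι ℂ (Matrix.single ⟨i + d, h⟩ ⟨i, by omega⟩ 1)) ∈ Ugl n := by
      intro d
      induction d with
      | zero =>
        intro i h
        have h0 := hdiag i h
        have : φ (UniversalEnvelopingAlgebra.ι ℂ (Matrix.single ⟨i, h⟩ ⟨i, h⟩ 1)) ∈ Ugl n := by
          rw [h0]
          exact Algebra.subset_adjoin (Or.inr ⟨i + 1, by omega, by omega, rfl⟩)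
        exact ⟨this, this⟩
      | succ d ih =>
        intro i h
        obtain ⟨h1, h2⟩ := ih i (by omega)
        have h3 := hplus (i + d) h
        have h4 := hminus (i + d) h
        have m3 : XPlus n (i + d + 1) ∈ Ugl n :=
          Algebra.subset_adjoin (Or.inl ⟨_, by omega, h, Or.inl rfl⟩)
        have m4 : XMinus n (i + d + 1) ∈ Ugl n :=
          Algebra.subset_adjoin (Or.inl ⟨_, by omega, h, Or.inr rfl⟩)
        rw [← h3] at m3
        rw [← h4] at m4
        exact ⟨hbr _ ⟨i + d, by omega⟩ _ (by simp [Fin.ext_iff]) h1 m3,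
          hbr _ ⟨i + d, by omega⟩ _ (by simp [Fin.ext_iff]) m4 h2⟩
    intro i j
    rcases le_total (i : ℕ) (j : ℕ) with h | h
    · have := (hup (j - i) i (by omega)).1
      have e : (⟨(i : ℕ) + (j - i), by omega⟩ : Fin n) = j := Fin.ext (by simp; omega)
      rwa [e] at this
    · have := (hup (i - j) j (by omega)).2
      have e : (⟨(j : ℕ) + (i - j), by omega⟩ : Fin n) = i := Fin.ext (by simp; omega)
      rwa [e] at this
  have hall : ∀ A : Matrix (Fin n) (Fin n) ℂ, φ (UniversalEnvelopingAlgebra.ι ℂ A) ∈ Ugl n := by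
    intro A
    rw [Matrix.matrix_eq_sum_single A, map_sum, map_sum]
    refine sum_mem fun i _ => ?_
    rw [map_sum, map_sum]
    refine sum_mem fun j _ => ?_
    have : (Matrix.single i j (A i j) : Matrix (Fin n) (Fin n) ℂ) =
        A i j • Matrix.single i j 1 := by simp
    rw [this, map_smul, map_smul]
    exact Subalgebra.smul_mem _ (hE i j) _
  apply le_antisymm
  · let f : Matrix (Fin n) (Fin n) ℂ →ₗ⁅ℂ⁆ Ugl n :=
      { toFun := fun A => ⟨φ (UniversalEnvelopingAlgebra.ι ℂ A), hall A⟩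
        map_add' := fun A B => Subtype.ext (by simp)
        map_smul' := fun c A => Subtype.ext (by simp)
        map_lie' := fun {A B} => Subtype.ext (by
          change φ (UniversalEnvelopingAlgebra.ι ℂ ⁅A, B⁆) =
            φ (UniversalEnvelopingAlgebra.ι ℂ A) * φ (UniversalEnvelopingAlgebra.ι ℂ B) -
            φ (UniversalEnvelopingAlgebra.ι ℂ B) * φ (UniversalEnvelopingAlgebra.ι ℂ A)
          rw [LieHom.map_lie, Ring.lie_def, map_sub, map_mul, map_mul]) }
    have : (Ugl n).val.comp (UniversalEnvelopingAlgebra.lift ℂ f) = φ := by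
      apply UniversalEnvelopingAlgebra.hom_ext
      ext A
      simp [f]
    rw [← this]
    rintro _ ⟨u, rfl⟩
    exact (UniversalEnvelopingAlgebra.lift ℂ f u).2
  · unfold Ugl
    rw [Algebra.adjoin_le_iff]
    rintro u (⟨k, hk, hkn, rfl | rfl⟩ | ⟨k, hk, hkn, rfl⟩) <;>
      obtain ⟨k, rfl⟩ := Nat.exists_eq_add_of_le' hk
    · exact ⟨_, hplus k hkn⟩
    · exact ⟨_, hminus k hkn⟩
    · exact ⟨_, hdiag k hkn⟩

end

/-! ### Galois rings and Galois orders -/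

/-- For subrings `Γ, K, 𝒦` of a ring `R`: the subring `U` of `R` is a Galois `Γ`-ring in `𝒦`,
i.e. `Γ ⊆ U ⊆ 𝒦`, `U` is finitely generated over `Γ`, and `K U = U K = 𝒦`. -/
structure IsGaloisRing {R : Type*} [Ring R] (Γ K 𝒦 U : Subring R) : Prop where
  base_le : Γ ≤ U
  le_ambient : U ≤ 𝒦
  fg : ∃ s : Finset R, Subring.closure ((Γ : Set R) ∪ s) = U
  left_span : (Submodule.span K (U : Set R) : Set R) = 𝒦
  right_span : (Submodule.span K.op (U : Set R) : Set R) = 𝒦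

/-- `U` is a left Galois `Γ`-order in `𝒦`: a Galois `Γ`-ring such that `W ∩ U` is a finitely
generated left `Γ`-module for every finite-dimensional left `K`-subspace `W ⊆ 𝒦`. -/
structure IsLeftGaloisOrder {R : Type*} [Ring R] (Γ K 𝒦 U : Subring R) : Prop
    extends IsGaloisRing Γ K 𝒦 U where
  left_fg : ∀ W : Submodule K R, W.FG → (W : Set R) ⊆ 𝒦 →
    ∃ t : Finset R, (Submodule.span Γ (t : Set R) : Set R) = (W : Set R) ∩ U

/-- `U` is a right Galois `Γ`-order in `𝒦`: a Galois `Γ`-ring such that `W ∩ U` is a finitely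
generated right `Γ`-module for every finite-dimensional right `K`-subspace `W ⊆ 𝒦`. Right
modules over a subring `S` of `R` are modules over `S.op ⊆ Rᵐᵒᵖ`, acting by right
multiplication. -/
structure IsRightGaloisOrder {R : Type*} [Ring R] (Γ K 𝒦 U : Subring R) : Prop
    extends IsGaloisRing Γ K 𝒦 U where
  right_fg : ∀ W : Submodule K.op R, W.FG → (W : Set R) ⊆ 𝒦 →
    ∃ t : Finset R, (Submodule.span Γ.op (t : Set R) : Set R) = (W : Set R) ∩ U

/-- `U` is a Galois `Γ`-order in `𝒦`: both a left and a right Galois `Γ`-order. -/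
def IsGaloisOrder {R : Type*} [Ring R] (Γ K 𝒦 U : Subring R) : Prop :=
  IsLeftGaloisOrder Γ K 𝒦 U ∧ IsRightGaloisOrder Γ K 𝒦 U

/-- The rational function
`∏_{i=1}^3 (x_{3i} - x_{21} + 1) / (x_{22} - x_{21} + 1) · (x_{11} - x_{21}) / (x_{22} - x_{21})`
times
`∏_{i=1}^3 (x_{3i} - x_{22} + 1) / (x_{21} - x_{22} + 1) · (x_{11} - x_{22}) / (x_{21} - x_{22})`
in `L`, for `n = 3`. -/
def specialElt : Frac 3 :=
  (∏ i ∈ Finset.Icc 1 3, (x 3 3 i - x 3 2 1 + 1)) / (x 3 2 2 - x 3 2 1 + 1) *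
    ((x 3 1 1 - x 3 2 1) / (x 3 2 2 - x 3 2 1)) *
    ((∏ i ∈ Finset.Icc 1 3, (x 3 3 i - x 3 2 2 + 1)) / (x 3 2 1 - x 3 2 2 + 1)) *
    ((x 3 1 1 - x 3 2 2) / (x 3 2 1 - x 3 2 2))

end

end AltExt

/-!
Everything happens on level `2`. Put `V = x_{21} - x_{22}`. Since `δ^{21}` and `δ^{22}` shift `V`
by `-1` and `+1`, the commutator of `V` with `X_2^± = T_1^± + T_2^±`, where
`T_i^± = (δ^{2i})^{±1} a_{2i}^±`, is `±(T_1^± - T_2^±)`. Hence the four summands `T_i^±` all lie in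
`𝒜(𝔤𝔩_n)` (`summands_mem_Agl`), and so does `f = T_1^+ T_1^- T_2^+ T_2^-`. Each `T_i^+ T_i^-` has
trivial shift part, so `f` is an element of `L` (`levelTwoProd`). It is `𝕊_n`-invariant because
`𝕊_n` permutes the two factors, it is the element of the second claim when `n = 3` (`levelTwoProd_eq`),
and it is not a polynomial, since its denominator vanishes at a point where its numerator does not
(`levelTwoProd_notMem`).

To see that `f ∉ U_n`, let `ℒ` act on `L` from the right by `h · (a μ) = μ⁻¹(a h)`. This side is the
good one: `h · (δ a) = a δ⁻¹(h)`, so the only denominators that arise are the products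
`∏_{j ≠ i} (x_{kj} - x_{ki})`, and `h · X_k^±` becomes a polynomial after multiplication by the
Vandermonde determinant of level `k`. For invariant `h` it is invariant as well, so its product with
the determinant is antisymmetric and therefore divisible by the determinant
(`mem_range_of_vandLam_mul`). Thus `U_n` preserves the invariant polynomials, and `f = 1 · f` would
be a polynomial if `f` were in `U_n` (`mem_range_of_ofFrac_mem_Ugl`).

Finally, if `𝒜(𝔤𝔩_n)` were a Galois order, then `K̃ ∩ 𝒜(𝔤𝔩_n)` would be a finitely generated
`Γ̃`-module containing all powers of `f`. So `f` would be integral over the integrally closed ring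
`Λ`, hence a polynomial (`isIntegral_of_isLeftGaloisOrder`).
-/

namespace AltExt

noncomputable section

/-! ### Antisymmetric polynomials and the Vandermonde determinant -/

/-- An algebra endomorphism which is the identity on the variables modulo `X p - X q` is the
identity modulo `X p - X q`. -/
lemma X_sub_X_dvd_sub {σ : Type*} (p q : σ) (φ : MvPolynomial σ ℂ →ₐ[ℂ] MvPolynomial σ ℂ)
    (hφ : ∀ r, (MvPolynomial.X p - MvPolynomial.X q : MvPolynomial σ ℂ) ∣
      MvPolynomial.X r - φ (MvPolynomial.X r)) (D : MvPolynomial σ ℂ) :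
    (MvPolynomial.X p - MvPolynomial.X q : MvPolynomial σ ℂ) ∣ D - φ D := by
  set I : Ideal (MvPolynomial σ ℂ) := Ideal.span {MvPolynomial.X p - MvPolynomial.X q}
  have h : Ideal.Quotient.mkₐ ℂ I = (Ideal.Quotient.mkₐ ℂ I).comp φ := by
    apply MvPolynomial.algHom_ext
    intro r
    simpa [Ideal.Quotient.eq, I, Ideal.mem_span_singleton] using hφ r
  have := DFunLike.congr_fun h D
  simpa [Ideal.Quotient.eq, I, Ideal.mem_span_singleton] using this

lemma X_sub_X_dvd_of_swap {σ : Type*} [DecidableEq σ] {p q : σ} {D : MvPolynomial σ ℂ}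
    (h : MvPolynomial.rename (Equiv.swap p q) D = -D) :
    (MvPolynomial.X p - MvPolynomial.X q : MvPolynomial σ ℂ) ∣ D := by
  have h1 := X_sub_X_dvd_sub p q (MvPolynomial.rename (Equiv.swap p q)) (fun r => by
    rw [MvPolynomial.rename_X]
    rcases eq_or_ne r p with rfl | hp
    · simp
    · rcases eq_or_ne r q with rfl | hq
      · rw [Equiv.swap_apply_right]
        exact ⟨-1, by ring⟩
      · simp [Equiv.swap_apply_of_ne_of_ne hp hq]) D
  rw [h, sub_neg_eq_add, ← two_mul] at h1
  -- `D` and its image under the swap agree modulo `X p - X q`, so `X p - X q` divides `2 D`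
  have h2 : IsUnit (2 : MvPolynomial σ ℂ) := by
    have := (IsUnit.mk0 (2 : ℂ) two_ne_zero).map (MvPolynomial.C (σ := σ))
    rwa [map_ofNat] at this
  exact (h2.dvd_mul_left).1 h1

lemma X_sub_X_dvd_iff {σ : Type*} [DecidableEq σ] (p q : σ) (D : MvPolynomial σ ℂ) :
    (MvPolynomial.X p - MvPolynomial.X q : MvPolynomial σ ℂ) ∣ D ↔
      MvPolynomial.rename (fun r => if r = p then q else r) D = 0 := by
  constructor
  · rintro ⟨E, rfl⟩
    rcases eq_or_ne q p with rfl | h <;> simp [*]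
  · intro h
    have := X_sub_X_dvd_sub p q (MvPolynomial.rename (fun r => if r = p then q else r))
      (fun r => by by_cases hr : r = p <;> simp [hr]) D
    rwa [h, sub_zero] at this

lemma prime_X_sub_X {σ : Type*} [DecidableEq σ] {p q : σ} (h : p ≠ q) :
    Prime (MvPolynomial.X p - MvPolynomial.X q : MvPolynomial σ ℂ) := by
  refine ⟨sub_ne_zero.2 fun h' => h (MvPolynomial.X_injective h'), fun hu => ?_, fun a b hab => ?_⟩
  · have := (X_sub_X_dvd_iff p q 1).1 hu.dvd
    simp at this
  · rw [X_sub_X_dvd_iff] at hab ⊢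
    rw [X_sub_X_dvd_iff]
    simpa using hab

lemma isRelPrime_X_sub_X {σ : Type*} [DecidableEq σ] {p q r s : σ} (h : p ≠ q)
    (h' : r ≠ s) (h1 : ¬ (p = r ∧ q = s)) (h2 : ¬ (p = s ∧ q = r)) :
    IsRelPrime (MvPolynomial.X p - MvPolynomial.X q : MvPolynomial σ ℂ)
      (MvPolynomial.X r - MvPolynomial.X s) := by
  rw [(prime_X_sub_X h).irreducible.isRelPrime_iff_not_dvd, X_sub_X_dvd_iff]
  intro h3
  rw [map_sub, MvPolynomial.rename_X, MvPolynomial.rename_X, sub_eq_zero] at h3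
  have := MvPolynomial.X_injective h3
  grind

/-- A polynomial which is antisymmetric in the variables `X (v i)` is divisible by their Vandermonde
determinant: the factors of the determinant divide it and are pairwise non-associated primes. -/
lemma vandermonde_dvd_of_swap {σ : Type*} [DecidableEq σ] {k : ℕ} {v : Fin k → σ}
    (hv : Function.Injective v) {D : MvPolynomial σ ℂ}
    (hD : ∀ i j, i ≠ j → MvPolynomial.rename (Equiv.swap (v i) (v j)) D = -D) :
    (Matrix.vandermonde fun i => (MvPolynomial.X (v i) : MvPolynomial σ ℂ)).det ∣ D := by
  rw [Matrix.det_vandermonde, Finset.prod_sigma']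
  apply Finset.prod_dvd_of_isRelPrime
  · rintro ⟨i, j⟩ hij ⟨i', j'⟩ hij' hne
    simp only [Finset.coe_sigma, Set.mem_sigma_iff, Finset.coe_univ, Set.mem_univ, true_and,
      Finset.coe_Ioi, Set.mem_Ioi] at hij hij'
    apply isRelPrime_X_sub_X
    · exact fun h => hij.ne' (hv h)
    · exact fun h => hij'.ne' (hv h)
    · rintro ⟨h1, h2⟩
      obtain rfl := hv h1
      obtain rfl := hv h2
      exact hne rfl
    · rintro ⟨h1, h2⟩
      obtain rfl := hv h1
      obtain rfl := hv h2
      exact lt_asymm hij hij'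
  · rintro ⟨i, j⟩ hij
    simp only [Finset.mem_sigma, Finset.mem_Ioi, Finset.mem_univ, true_and] at hij
    exact X_sub_X_dvd_of_swap (hD j i hij.ne')

lemma rename_swap_vandermonde {σ : Type*} [DecidableEq σ] {k : ℕ} {v : Fin k → σ}
    (hv : Function.Injective v) {i j : Fin k} (hij : i ≠ j) :
    MvPolynomial.rename (Equiv.swap (v i) (v j))
      (Matrix.vandermonde fun i => (MvPolynomial.X (v i) : MvPolynomial σ ℂ)).det =
      -(Matrix.vandermonde fun i => (MvPolynomial.X (v i) : MvPolynomial σ ℂ)).det := by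
  rw [AlgHom.map_det]
  have := Matrix.det_permute (Equiv.swap i j)
    (Matrix.vandermonde fun i => (MvPolynomial.X (v i) : MvPolynomial σ ℂ))
  rw [Equiv.Perm.sign_swap hij] at this
  simp only [Units.val_neg, Units.val_one, Int.cast_neg, Int.cast_one, neg_mul, one_mul] at this
  rw [← this]
  congr 1
  ext1 a b
  simp [Matrix.vandermonde_apply, ← hv.swap_apply]

lemma prod_X_sub_X_dvd_vandermonde {σ : Type*} [DecidableEq σ] {k : ℕ} {v : Fin k → σ}
    (hv : Function.Injective v) (i : Fin k) :
    ∏ j ∈ Finset.univ.erase i, (MvPolynomial.X (v j) - MvPolynomial.X (v i)) ∣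
      (Matrix.vandermonde fun i => (MvPolynomial.X (v i) : MvPolynomial σ ℂ)).det := by
  apply Finset.prod_dvd_of_isRelPrime
  · intro j hj j' hj' hne
    simp only [Finset.coe_erase, Finset.coe_univ, Set.mem_sdiff, Set.mem_univ, true_and,
      Set.mem_singleton_iff] at hj hj'
    apply isRelPrime_X_sub_X
    · exact hv.ne hj
    · exact hv.ne hj'
    · exact fun h => hne (hv h.1)
    · exact fun h => hj (hv h.1)
  · intro j hj
    exact X_sub_X_dvd_of_swap (rename_swap_vandermonde hv (Finset.ne_of_mem_erase hj))

/-! ### Invariance of the generators -/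

/-- The permutation of `ℕ` which acts on `{1, …, k}` as the component `g_k` of `g` and
fixes all other numbers; it is the identity if `k ∉ {1, …, n}`. With it, `g` sends `x_{ki}` to
`x_{k, permN g k i}` for all natural numbers `k` and `i`. -/
def permN {n : ℕ} (g : SymProd n) (k : ℕ) : Equiv.Perm ℕ :=
  if h : k ∈ Finset.Icc 1 n then Equiv.Perm.ofSubtype (p := (· ∈ Finset.Icc 1 k)) (g ⟨k, h⟩) else 1

lemma permN_mem {n : ℕ} (g : SymProd n) (k i : ℕ) :
    permN g k i ∈ Finset.Icc 1 k ↔ i ∈ Finset.Icc 1 k := by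
  unfold permN
  split_ifs with h
  · exact Equiv.Perm.ofSubtype_apply_mem_iff_mem (p := (· ∈ Finset.Icc 1 k)) (g ⟨k, h⟩) i
  · rfl

lemma permIdx_mkIdx {n : ℕ} (g : SymProd n) {k i : ℕ} (h : 1 ≤ i ∧ i ≤ k ∧ k ≤ n)
    (h' : 1 ≤ permN g k i ∧ permN g k i ≤ k ∧ k ≤ n) :
    permIdx g (mkIdx n k i h) = mkIdx n k (permN g k i) h' := by
  have hk : k ∈ Finset.Icc 1 n := Finset.mem_Icc.2 ⟨h.1.trans h.2.1, h.2.2⟩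
  have hi : i ∈ Finset.Icc 1 k := Finset.mem_Icc.2 ⟨h.1, h.2.1⟩
  have : permN g k i = (g ⟨k, hk⟩ ⟨i, hi⟩ : ℕ) := by
    rw [permN, dif_pos hk]
    exact Equiv.Perm.ofSubtype_apply_of_mem (p := (· ∈ Finset.Icc 1 k)) (g ⟨k, hk⟩) hi
  unfold mkIdx permIdx
  simp only [Equiv.sigmaCongrRight_apply]
  congr 1
  exact Subtype.ext this.symm

lemma permN_range {n : ℕ} (g : SymProd n) {k i : ℕ} :
    (1 ≤ permN g k i ∧ permN g k i ≤ k ∧ k ≤ n) ↔ (1 ≤ i ∧ i ≤ k ∧ k ≤ n) := by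
  have := permN_mem g k i
  simp only [Finset.mem_Icc] at this
  tauto

lemma symFrac_algebraMap {n : ℕ} (g : SymProd n) (f : Lam n) :
    symFrac n g (algebraMap (Lam n) (Frac n) f) = algebraMap (Lam n) (Frac n) (symLam n g f) :=
  extAut_algebraMap _ _

lemma symFrac_x {n : ℕ} (g : SymProd n) (k i : ℕ) :
    symFrac n g (x n k i) = x n k (permN g k i) := by
  unfold x
  by_cases h : 1 ≤ i ∧ i ≤ k ∧ k ≤ n
  · rw [dif_pos h, dif_pos ((permN_range g).2 h), symFrac_algebraMap, symLam_X,
      permIdx_mkIdx g h ((permN_range g).2 h)]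
  · rw [dif_neg h, dif_neg (fun h' => h ((permN_range g).1 h')), map_zero]

lemma prod_permN {M : Type*} [CommMonoid M] {n : ℕ} (g : SymProd n) (k : ℕ) (f : ℕ → M) :
    ∏ i ∈ Finset.Icc 1 k, f (permN g k i) = ∏ i ∈ Finset.Icc 1 k, f i :=
  Finset.prod_equiv (permN g k) (fun i => (permN_mem g k i).symm) fun _ _ => rfl

lemma sum_permN {M : Type*} [AddCommMonoid M] {n : ℕ} (g : SymProd n) (k : ℕ) (f : ℕ → M) :
    ∑ i ∈ Finset.Icc 1 k, f (permN g k i) = ∑ i ∈ Finset.Icc 1 k, f i :=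
  Finset.sum_equiv (permN g k) (fun i => (permN_mem g k i).symm) fun _ _ => rfl

lemma prod_erase_permN {M : Type*} [CommMonoid M] {n : ℕ} (g : SymProd n) (k i : ℕ) (f : ℕ → M) :
    ∏ j ∈ (Finset.Icc 1 k).erase i, f (permN g k j) =
      ∏ j ∈ (Finset.Icc 1 k).erase (permN g k i), f j :=
  Finset.prod_equiv (permN g k)
    (fun j => by rw [Finset.mem_erase, Finset.mem_erase, permN_mem, (permN g k).injective.ne_iff])
    fun _ _ => rfl

lemma symFrac_aPlus {n : ℕ} (g : SymProd n) (k i : ℕ) :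
    symFrac n g (aPlus n k i) = aPlus n k (permN g k i) := by
  unfold aPlus
  simp only [map_neg, map_div₀, map_prod, map_sub, symFrac_x]
  rw [prod_permN g (k + 1) fun j => x n (k + 1) j - x n k (permN g k i),
    prod_erase_permN g k i fun j => x n k j - x n k (permN g k i)]

lemma symFrac_aMinus {n : ℕ} (g : SymProd n) (k i : ℕ) :
    symFrac n g (aMinus n k i) = aMinus n k (permN g k i) := by
  unfold aMinus
  simp only [map_div₀, map_prod, map_sub, symFrac_x]
  rw [prod_permN g (k - 1) fun j => x n (k - 1) j - x n k (permN g k i),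
    prod_erase_permN g k i fun j => x n k j - x n k (permN g k i)]

lemma conjShift_dl {n : ℕ} (g : SymProd n) (k i : ℕ) :
    conjShift g (dl n k i) = dl n k (permN g k i) := by
  unfold dl
  by_cases h : (1 ≤ i ∧ i ≤ k ∧ k ≤ n) ∧ k < n
  · have h' := (permN_range g).2 h.1
    rw [dif_pos h, dif_pos ⟨h', h.2⟩]
    apply Subtype.ext
    rw [conjShift_coe]
    change _ * delta _ * _ = delta _
    rw [conj_delta, permIdx_mkIdx g h.1 h']
  · rw [dif_neg h, dif_neg (fun h' => h ⟨(permN_range g).1 h'.1, h'.2⟩), map_one]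

lemma ofFrac_apply {n : ℕ} (a : Frac n) : ofFrac n a = SkewMonoidAlgebra.single 1 a := rfl

lemma ofShift_mul_ofFrac {n : ℕ} (μ : shifts n) (a : Frac n) :
    ofShift n μ * ofFrac n a = SkewMonoidAlgebra.single μ (μ • a) := by
  rw [ofFrac_apply, ofShift, SkewMonoidAlgebra.of_apply, SkewMonoidAlgebra.single_mul_single]
  simp

lemma symSkew_ofFrac {n : ℕ} (g : SymProd n) (a : Frac n) :
    symSkew g (ofFrac n a) = ofFrac n (symFrac n g a) := by
  rw [ofFrac_apply, symSkew_single, map_one, ofFrac_apply]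

lemma symSkew_ofShift {n : ℕ} (g : SymProd n) (μ : shifts n) :
    symSkew g (ofShift n μ) = ofShift n (conjShift g μ) := by
  rw [ofShift, SkewMonoidAlgebra.of_apply, symSkew_single, map_one, SkewMonoidAlgebra.of_apply]

lemma symSkew_XPlus {n : ℕ} (g : SymProd n) (k : ℕ) : symSkew g (XPlus n k) = XPlus n k := by
  unfold XPlus
  simp only [map_sum, map_mul, symSkew_ofShift, symSkew_ofFrac, conjShift_dl, symFrac_aPlus]
  exact sum_permN g k fun i => ofShift n (dl n k i) * ofFrac n (aPlus n k i)

lemma symSkew_XMinus {n : ℕ} (g : SymProd n) (k : ℕ) : symSkew g (XMinus n k) = XMinus n k := by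
  unfold XMinus
  simp only [map_sum, map_mul, symSkew_ofShift, symSkew_ofFrac, map_inv, conjShift_dl,
    symFrac_aMinus]
  exact sum_permN g k fun i => ofShift n (dl n k i)⁻¹ * ofFrac n (aMinus n k i)

lemma symSkew_XDiag {n : ℕ} (g : SymProd n) (k : ℕ) : symSkew g (XDiag n k) = XDiag n k := by
  unfold XDiag
  rw [symSkew_ofFrac]
  congr 1
  simp only [map_sub, map_sum, map_add, symFrac_x, map_natCast, map_one, Finset.sum_sub_distrib,
    Finset.sum_add_distrib]
  rw [sum_permN g k fun i => x n k i, sum_permN g (k - 1) fun i => x n (k - 1) i]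

lemma Ugl_le_invSkew (n : ℕ) : Ugl n ≤ invSkew n ⊤ := by
  unfold Ugl
  rw [Algebra.adjoin_le_iff]
  rintro u (⟨k, -, -, rfl | rfl⟩ | ⟨k, -, -, rfl⟩) <;> refine mem_invSkew.2 fun g _ => ?_
  · exact symSkew_XPlus g k
  · exact symSkew_XMinus g k
  · exact symSkew_XDiag g k

/-! ### The right action of `ℒ` on `L` -/

/-- The right action of `ℒ` on `L`, `h · (a μ) = μ⁻¹(a h)`, as a homomorphism to the opposite of
the algebra of `ℂ`-linear endomorphisms of `L`. -/
def rightAct (n : ℕ) : SkewRing n →ₐ[ℂ] (Module.End ℂ (Frac n))ᵐᵒᵖ :=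
  SkewMonoidAlgebra.liftNCAlgHom
    ((Algebra.lmul ℂ (Frac n)).toOpposite fun a b => by
      rw [commute_iff_eq, ← map_mul, ← map_mul, mul_comm])
    { toFun := fun μ => MulOpposite.op (DistribSMul.toLinearMap ℂ (Frac n) μ⁻¹)
      map_one' := by
        apply MulOpposite.unop_injective
        ext h
        simp
      map_mul' := fun μ ν => by
        apply MulOpposite.unop_injective
        ext h
        simp [mul_smul] }
    (by
      intro a μ
      apply MulOpposite.unop_injective
      refine LinearMap.ext fun h => ?_
      change μ⁻¹ • ((μ • a) * h) = a * μ⁻¹ • h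
      rw [smul_mul', inv_smul_smul])

lemma rightAct_single {n : ℕ} (μ : shifts n) (a h : Frac n) :
    (rightAct n (SkewMonoidAlgebra.single μ a)).unop h = μ⁻¹ • (a * h) := by
  change (SkewMonoidAlgebra.liftNC _ _ _ : (Module.End ℂ (Frac n))ᵐᵒᵖ).unop h = _
  rw [SkewMonoidAlgebra.liftNC_single]
  rfl

lemma rightAct_ofFrac {n : ℕ} (a h : Frac n) : (rightAct n (ofFrac n a)).unop h = a * h := by
  rw [ofFrac_apply, rightAct_single, inv_one, one_smul]

lemma rightAct_ofShift_mul_ofFrac {n : ℕ} (μ : shifts n) (a h : Frac n) :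
    (rightAct n (ofShift n μ * ofFrac n a)).unop h = a * μ⁻¹ • h := by
  rw [ofShift_mul_ofFrac, rightAct_single, smul_mul', inv_smul_smul]

/-- The right action is `𝕊_n`-equivariant. -/
lemma symFrac_rightAct {n : ℕ} (g : SymProd n) (u : SkewRing n) (h : Frac n) :
    symFrac n g ((rightAct n u).unop h) = (rightAct n (symSkew g u)).unop (symFrac n g h) := by
  induction u using SkewMonoidAlgebra.induction_on with
  | zero => simp
  | single μ a =>
    rw [symSkew_single, rightAct_single, rightAct_single, symFrac_smul, map_mul, map_inv]
  | add u v hu hv => simp [hu, hv]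

/-! ### Invariant polynomials are preserved by the right action of `U_n` -/

/-- The index `(k, t + 1)`, where `t` runs through `{0, …, k - 1}`. -/
def lvl {n k : ℕ} (hkn : k ≤ n) (t : Fin k) : Idx n := mkIdx n k (t + 1) ⟨by omega, t.2, hkn⟩

lemma lvl_injective {n k : ℕ} (hkn : k ≤ n) : Function.Injective (lvl hkn) := by
  intro s t h
  simp only [lvl, mkIdx, Sigma.mk.injEq, heq_eq_eq, true_and, Subtype.mk.injEq] at h
  exact Fin.ext (by omega)

lemma x_eq_lvl {n k : ℕ} (hkn : k ≤ n) (t : Fin k) :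
    x n k (t + 1) = algebraMap (Lam n) (Frac n) (MvPolynomial.X (lvl hkn t)) :=
  dif_pos _

/-- The Vandermonde determinant in the variables of level `k`. -/
def vandLam {n k : ℕ} (hkn : k ≤ n) : Lam n :=
  (Matrix.vandermonde fun t => MvPolynomial.X (lvl hkn t)).det

/-- Transpositions of two variables of level `k` come from `𝕊_n`. -/
lemma exists_symLam_eq_rename_swap {n k : ℕ} (hkn : k ≤ n) (s t : Fin k) :
    ∃ g : SymProd n, ∀ f : Lam n,
      symLam n g f = MvPolynomial.rename (Equiv.swap (lvl hkn s) (lvl hkn t)) f := by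
  have hk : k ∈ Finset.Icc 1 n := Finset.mem_Icc.2 ⟨by have := s.2; omega, hkn⟩
  refine ⟨Pi.mulSingle ⟨k, hk⟩ (Equiv.swap (lvl hkn s).2 (lvl hkn t).2), fun f => ?_⟩
  change MvPolynomial.rename (permIdx _) f = _
  congr 2
  funext ⟨l, i⟩
  change (⟨l, _⟩ : Idx n) = _
  rcases eq_or_ne l ⟨k, hk⟩ with rfl | hl
  · rw [Pi.mulSingle_eq_same]
    exact ((sigma_mk_injective (β := fun k : Finset.Icc 1 n => Finset.Icc 1 (k : ℕ))
      (i := ⟨k, hk⟩)).swap_apply (lvl hkn s).2 (lvl hkn t).2 i).symm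
  · rw [Pi.mulSingle_eq_of_ne hl, Equiv.swap_apply_of_ne_of_ne]
    · rfl
    · exact fun h => hl (congrArg Sigma.fst h)
    · exact fun h => hl (congrArg Sigma.fst h)

/-- An `𝕊_n`-invariant rational function whose product with the Vandermonde determinant of some
level is a polynomial is itself a polynomial. -/
lemma mem_range_of_vandLam_mul {n k : ℕ} (hkn : k ≤ n) {F : Frac n} {D : Lam n}
    (hF : ∀ g, symFrac n g F = F)
    (hD : algebraMap (Lam n) (Frac n) D = algebraMap (Lam n) (Frac n) (vandLam hkn) * F) :
    F ∈ Set.range (algebraMap (Lam n) (Frac n)) := by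
  have hinj := IsFractionRing.injective (Lam n) (Frac n)
  have hdvd : vandLam hkn ∣ D := by
    apply vandermonde_dvd_of_swap (lvl_injective hkn)
    intro s t hst
    obtain ⟨g, hg⟩ := exists_symLam_eq_rename_swap hkn s t
    apply hinj
    rw [← hg, ← symFrac_algebraMap, hD, map_mul, hF, symFrac_algebraMap, hg, map_neg, hD, vandLam,
      rename_swap_vandermonde (lvl_injective hkn) hst, map_neg, neg_mul]
  obtain ⟨G, rfl⟩ := hdvd
  rw [map_mul] at hD
  refine ⟨G, mul_left_cancel₀ ?_ hD⟩
  rw [Ne, map_eq_zero_iff _ hinj]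
  exact Matrix.det_vandermonde_ne_zero_iff.2
    ((MvPolynomial.X_injective).comp (lvl_injective hkn))

lemma prod_erase_succ {M : Type*} [CommMonoid M] {k : ℕ} (s : Fin k) (f : ℕ → M) :
    ∏ j ∈ (Finset.Icc 1 k).erase (s + 1 : ℕ), f j = ∏ t ∈ Finset.univ.erase s, f (t + 1) := by
  symm
  apply Finset.prod_bij (fun (t : Fin k) _ => (t : ℕ) + 1)
  · intro t ht
    have := Finset.ne_of_mem_erase ht
    have := t.2
    simp only [Finset.mem_erase, Finset.mem_Icc, Ne, Fin.ext_iff] at *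
    omega
  · intro t _ t' _ h
    exact Fin.ext (by omega)
  · intro j hj
    simp only [Finset.mem_erase, Finset.mem_Icc] at hj
    refine ⟨⟨j - 1, by omega⟩, ?_, by simp; omega⟩
    simp only [Finset.mem_erase, Finset.mem_univ, and_true, Ne, Fin.ext_iff]
    omega
  · exact fun _ _ => rfl

/-- The Vandermonde determinant of level `k` clears the denominator
`∏_{j ≠ i} (x_{kj} - x_{ki})`. -/
lemma vandLam_mul_div {n k : ℕ} (hkn : k ≤ n) {i : ℕ} (hi : i ∈ Finset.Icc 1 k) (N : Lam n) :
    ∃ D : Lam n, algebraMap (Lam n) (Frac n) D = algebraMap (Lam n) (Frac n) (vandLam hkn) *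
      (algebraMap (Lam n) (Frac n) N / ∏ j ∈ (Finset.Icc 1 k).erase i, (x n k j - x n k i)) := by
  rw [Finset.mem_Icc] at hi
  obtain ⟨s, rfl⟩ : ∃ s : Fin k, i = s + 1 := ⟨⟨i - 1, by omega⟩, by simp; omega⟩
  have hprod : ∏ j ∈ (Finset.Icc 1 k).erase (s + 1 : ℕ), (x n k j - x n k (s + 1)) =
      algebraMap (Lam n) (Frac n) (∏ t ∈ Finset.univ.erase s,
        (MvPolynomial.X (lvl hkn t) - MvPolynomial.X (lvl hkn s))) := by
    refine (prod_erase_succ s fun j => x n k j - x n k (s + 1)).trans ?_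
    refine Eq.trans (Finset.prod_congr rfl fun t _ => ?_) (map_prod _ _ _).symm
    rw [map_sub, x_eq_lvl hkn, x_eq_lvl hkn]
  obtain ⟨C, hC⟩ := prod_X_sub_X_dvd_vandermonde (lvl_injective hkn) s
  have hne : algebraMap (Lam n) (Frac n) (∏ t ∈ Finset.univ.erase s,
        (MvPolynomial.X (lvl hkn t) - MvPolynomial.X (lvl hkn s))) ≠ 0 := by
    rw [Ne, map_eq_zero_iff _ (IsFractionRing.injective (Lam n) (Frac n)), Finset.prod_eq_zero_iff]
    rintro ⟨t, ht, h⟩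
    exact Finset.ne_of_mem_erase ht
      (lvl_injective hkn (MvPolynomial.X_injective (sub_eq_zero.1 h)))
  refine ⟨C * N, ?_⟩
  rw [hprod, vandLam, hC, map_mul, map_mul]
  field_simp

lemma x_mem_range (n k i : ℕ) : x n k i ∈ (algebraMap (Lam n) (Frac n)).range := by
  unfold x
  split_ifs
  · exact ⟨_, rfl⟩
  · exact zero_mem _

lemma smul_mem_range {n : ℕ} (μ : shifts n) {a : Frac n}
    (ha : a ∈ (algebraMap (Lam n) (Frac n)).range) :
    μ • a ∈ (algebraMap (Lam n) (Frac n)).range := by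
  obtain ⟨f, rfl⟩ := ha
  exact ⟨(μ : Lam n ≃ₐ[ℂ] Lam n) f, (extAut_algebraMap _ _).symm⟩

/-- Elements of the shape of `X_k^±` send a polynomial to a polynomial as soon as the result is
`𝕊_n`-invariant. -/
lemma rightAct_sum_mem_range {n k : ℕ} (hkn : k ≤ n) (μ : ℕ → shifts n) (c : ℕ → Frac n)
    (hc : ∀ i, c i ∈ (algebraMap (Lam n) (Frac n)).range) {h : Frac n}
    (hh : h ∈ (algebraMap (Lam n) (Frac n)).range) {u : SkewRing n}
    (hu : u = ∑ i ∈ Finset.Icc 1 k, ofShift n (μ i) *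
      ofFrac n (c i / ∏ j ∈ (Finset.Icc 1 k).erase i, (x n k j - x n k i)))
    (hinv : ∀ g, symFrac n g ((rightAct n u).unop h) = (rightAct n u).unop h) :
    (rightAct n u).unop h ∈ (algebraMap (Lam n) (Frac n)).range := by
  have hD : ∀ i ∈ Finset.Icc 1 k, algebraMap (Lam n) (Frac n) (vandLam hkn) *
      (rightAct n (ofShift n (μ i) *
        ofFrac n (c i / ∏ j ∈ (Finset.Icc 1 k).erase i, (x n k j - x n k i)))).unop h ∈
      (algebraMap (Lam n) (Frac n)).range := by
    intro i hi
    obtain ⟨N, hN⟩ := mul_mem (hc i) (smul_mem_range (μ i)⁻¹ hh)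
    obtain ⟨D, hD⟩ := vandLam_mul_div hkn hi N
    refine ⟨D, ?_⟩
    rw [hD, hN, rightAct_ofShift_mul_ofFrac, div_mul_eq_mul_div]
  have hsum := sum_mem hD
  rw [← Finset.mul_sum] at hsum
  have : (rightAct n u).unop h = ∑ i ∈ Finset.Icc 1 k, (rightAct n (ofShift n (μ i) *
        ofFrac n (c i / ∏ j ∈ (Finset.Icc 1 k).erase i, (x n k j - x n k i)))).unop h := by
    rw [hu, map_sum, Finset.unop_sum, LinearMap.sum_apply]
  rw [← this] at hsum
  obtain ⟨D, hD⟩ := hsum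
  exact mem_range_of_vandLam_mul hkn hinv hD

/-- The right action of `U_n` maps invariant polynomials to (invariant) polynomials. -/
lemma rightAct_mem_of_mem_Ugl {n : ℕ} {u : SkewRing n} (hu : u ∈ Ugl n) :
    ∀ h : Frac n, h ∈ (algebraMap (Lam n) (Frac n)).range → (∀ g, symFrac n g h = h) →
      (rightAct n u).unop h ∈ (algebraMap (Lam n) (Frac n)).range := by
  have hinv : ∀ u ∈ Ugl n, ∀ h : Frac n, (∀ g, symFrac n g h = h) →
      ∀ g, symFrac n g ((rightAct n u).unop h) = (rightAct n u).unop h := by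
    intro u hu h hh g
    rw [symFrac_rightAct, hh, mem_invSkew.1 (Ugl_le_invSkew n hu) g trivial]
  unfold Ugl at hu
  induction hu using Algebra.adjoin_induction with
  | mem u hu =>
    intro h hh hs
    have hu' := hinv u (Algebra.subset_adjoin hu) h hs
    rcases hu with ⟨k, hk, hkn, rfl | rfl⟩ | ⟨k, hk, hkn, rfl⟩
    · refine rightAct_sum_mem_range hkn.le (fun i => dl n k i)
        (fun i => -∏ j ∈ Finset.Icc 1 (k + 1), (x n (k + 1) j - x n k i)) (fun i => ?_) hh ?_ hu'
      · exact neg_mem (prod_mem fun j _ => sub_mem (x_mem_range _ _ _) (x_mem_range _ _ _))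
      · rw [XPlus]
        refine Finset.sum_congr rfl fun i _ => congrArg (fun a => _ * ofFrac n a) ?_
        exact (neg_div _ _).symm
    · refine rightAct_sum_mem_range hkn.le (fun i => (dl n k i)⁻¹)
        (fun i => ∏ j ∈ Finset.Icc 1 (k - 1), (x n (k - 1) j - x n k i)) (fun i => ?_) hh ?_ hu'
      · exact prod_mem fun j _ => sub_mem (x_mem_range _ _ _) (x_mem_range _ _ _)
      · rfl
    · rw [XDiag, rightAct_ofFrac]
      refine mul_mem (sub_mem (sum_mem fun j _ => ?_) (sum_mem fun j _ => ?_)) hh <;>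
        exact sub_mem (add_mem (x_mem_range _ _ _) (natCast_mem _ _)) (one_mem _)
  | algebraMap r =>
    intro h hh _
    rw [AlgHom.commutes]
    change r • h ∈ _
    rw [Algebra.smul_def, IsScalarTower.algebraMap_apply ℂ (Lam n) (Frac n)]
    exact mul_mem ⟨_, rfl⟩ hh
  | add u v _ _ ihu ihv =>
    intro h hh hs
    rw [map_add]
    exact add_mem (ihu h hh hs) (ihv h hh hs)
  | mul u v hu hv ihu ihv =>
    intro h hh hs
    rw [map_mul]
    exact ihv _ (ihu h hh hs) (hinv u hu h hs)

/-- `U_n ∩ L` consists of polynomials: `a ∈ L` is the image of `1` under the right action of `a`. -/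
lemma mem_range_of_ofFrac_mem_Ugl {n : ℕ} {a : Frac n} (ha : ofFrac n a ∈ Ugl n) :
    a ∈ Set.range (algebraMap (Lam n) (Frac n)) := by
  have := rightAct_mem_of_mem_Ugl ha 1 (one_mem _) fun g => map_one _
  rwa [rightAct_ofFrac, mul_one] at this

/-! ### Splitting `X_2^±` with the Vandermonde polynomial of level `2` -/

lemma dl_smul_x_self {n k i : ℕ} (h : (1 ≤ i ∧ i ≤ k ∧ k ≤ n) ∧ k < n) :
    dl n k i • x n k i = x n k i - 1 := by
  rw [shifts_smul_def, dl, dif_pos h, x, dif_pos h.1, extAut_algebraMap]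
  change algebraMap _ _ (delta _ _) = _
  rw [delta_X, if_pos rfl, map_sub, map_one]

lemma dl_smul_x_of_ne {n k i l j : ℕ} (h : ¬ (l = k ∧ j = i)) :
    dl n k i • x n l j = x n l j := by
  by_cases hl : 1 ≤ j ∧ j ≤ l ∧ l ≤ n
  · by_cases hk : (1 ≤ i ∧ i ≤ k ∧ k ≤ n) ∧ k < n
    · rw [shifts_smul_def, dl, dif_pos hk, x, dif_pos hl, extAut_algebraMap]
      change algebraMap _ _ (delta _ _) = _
      rw [delta_X, if_neg, sub_zero]
      intro h'
      obtain rfl : l = k := congrArg (fun p : Idx n => (p.1 : ℕ)) h'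
      exact h ⟨rfl, congrArg (fun p : Idx n => (p.2 : ℕ)) h'⟩
    · rw [dl, dif_neg hk, one_smul]
  · rw [x, dif_neg hl, smul_zero]

/-- If `μ` and `ν` shift `V` by opposite nonzero constants, then a subalgebra containing `V` and
`μ a + ν b` contains both summands: commutation with `V` multiplies them by opposite constants. -/
lemma mem_of_add_mem {n : ℕ} {A : Subalgebra ℂ (SkewRing n)} {V a b : Frac n} {μ ν : shifts n}
    {c : ℂ} (hc : c ≠ 0) (hV : ofFrac n V ∈ A)
    (hμ : V - μ • V = algebraMap ℂ (Frac n) c) (hν : V - ν • V = algebraMap ℂ (Frac n) (-c))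
    (h : ofShift n μ * ofFrac n a + ofShift n ν * ofFrac n b ∈ A) :
    ofShift n μ * ofFrac n a ∈ A ∧ ofShift n ν * ofFrac n b ∈ A := by
  have key : ∀ (τ : shifts n) (e : Frac n), ofFrac n V * (ofShift n τ * ofFrac n e) -
      (ofShift n τ * ofFrac n e) * ofFrac n V =
      ofFrac n (V - τ • V) * (ofShift n τ * ofFrac n e) := by
    intro τ e
    rw [sub_eq_iff_eq_add, mul_assoc, ← map_mul, ofShift_mul_ofFrac, ofShift_mul_ofFrac,
      ofFrac_apply, ofFrac_apply, SkewMonoidAlgebra.single_mul_single,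
      SkewMonoidAlgebra.single_mul_single, one_smul, one_mul, smul_mul',
      ← SkewMonoidAlgebra.single_add]
    congr 1
    ring
  have h1 := key μ a
  have h2 := key ν b
  rw [hμ, AlgHom.commutes, ← Algebra.smul_def] at h1
  rw [hν, AlgHom.commutes, ← Algebra.smul_def, neg_smul] at h2
  set S := ofShift n μ * ofFrac n a
  set T := ofShift n ν * ofFrac n b
  have h3 : c • S - c • T ∈ A := by
    have : c • S - c • T = ofFrac n V * (S + T) - (S + T) * ofFrac n V := by
      rw [mul_add, add_mul, add_sub_add_comm, h1, h2, sub_eq_add_neg]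
    rw [this]
    exact sub_mem (mul_mem hV h) (mul_mem h hV)
  have h4 : c • S + c • T ∈ A := by
    rw [← smul_add]
    exact A.smul_mem h c
  have hS : S = (2 * c)⁻¹ • ((c • S + c • T) + (c • S - c • T)) := by
    rw [add_add_sub_cancel, ← two_smul ℂ, smul_smul, smul_smul, mul_assoc, inv_mul_cancel₀,
      one_smul]
    exact mul_ne_zero two_ne_zero hc
  have hSA : S ∈ A := by
    rw [hS]
    exact A.smul_mem (add_mem h4 h3) _
  exact ⟨hSA, by simpa using sub_mem h hSA⟩

lemma Icc_one_two_erase_one : (Finset.Icc 1 2).erase 1 = {2} := by decide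

lemma Icc_one_two_erase_two : (Finset.Icc 1 2).erase 2 = {1} := by decide

lemma ofFrac_vander_two_mem (n : ℕ) (hn : 3 ≤ n) : ofFrac n (x n 2 1 - x n 2 2) ∈ Agl n := by
  have h : vander n 2 = ofFrac n (x n 2 1 - x n 2 2) := by
    have h1 : (Finset.Icc 1 2 : Finset ℕ) = {1, 2} := by decide
    have h2 : (Finset.Ioc 1 2 : Finset ℕ) = {2} := by decide
    rw [vander, h1, Finset.prod_pair (by decide), Finset.Ioc_self, h2, Finset.prod_empty, mul_one,
      Finset.prod_singleton]
  rw [← h]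
  exact Algebra.subset_adjoin (Or.inr ⟨2, le_rfl, by omega, rfl⟩)

lemma Ugl_le_Agl (n : ℕ) : Ugl n ≤ Agl n :=
  fun _ hu => Algebra.subset_adjoin (Or.inl hu)

lemma summands_mem_Agl {n : ℕ} (hn : 3 ≤ n) {i : ℕ} (hi : i ∈ Finset.Icc 1 2) :
    ofShift n (dl n 2 i) * ofFrac n (aPlus n 2 i) ∈ Agl n ∧
      ofShift n (dl n 2 i)⁻¹ * ofFrac n (aMinus n 2 i) ∈ Agl n := by
  have h12 : (Finset.Icc 1 2 : Finset ℕ) = {1, 2} := by decide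
  have hP : XPlus n 2 ∈ Agl n :=
    Ugl_le_Agl n (Algebra.subset_adjoin (Or.inl ⟨2, by omega, by omega, Or.inl rfl⟩))
  have hM : XMinus n 2 ∈ Agl n :=
    Ugl_le_Agl n (Algebra.subset_adjoin (Or.inl ⟨2, by omega, by omega, Or.inr rfl⟩))
  rw [XPlus, h12, Finset.sum_pair (by decide)] at hP
  rw [XMinus, h12, Finset.sum_pair (by decide)] at hM
  have e1 : dl n 2 1 • (x n 2 1 - x n 2 2) = x n 2 1 - x n 2 2 - 1 := by
    rw [smul_sub, dl_smul_x_self (by omega), dl_smul_x_of_ne (by omega)]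
    ring
  have e2 : dl n 2 2 • (x n 2 1 - x n 2 2) = x n 2 1 - x n 2 2 + 1 := by
    rw [smul_sub, dl_smul_x_self (by omega), dl_smul_x_of_ne (by omega)]
    ring
  have e3 : (dl n 2 1)⁻¹ • (x n 2 1 - x n 2 2) = x n 2 1 - x n 2 2 + 1 := by
    rw [inv_smul_eq_iff, smul_add, e1, smul_one]
    ring
  have e4 : (dl n 2 2)⁻¹ • (x n 2 1 - x n 2 2) = x n 2 1 - x n 2 2 - 1 := by
    rw [inv_smul_eq_iff, smul_sub, e2, smul_one]
    ring
  have hP' := mem_of_add_mem (one_ne_zero) (ofFrac_vander_two_mem n hn) (by rw [e1]; simp)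
    (by rw [e2]; simp) hP
  have hM' := mem_of_add_mem (neg_ne_zero.2 one_ne_zero) (ofFrac_vander_two_mem n hn)
    (by rw [e3]; simp) (by rw [e4]; simp) hM
  rw [h12, Finset.mem_insert, Finset.mem_singleton] at hi
  rcases hi with rfl | rfl
  · exact ⟨hP'.1, hM'.1⟩
  · exact ⟨hP'.2, hM'.2⟩

/-! ### The invariant rational function -/

/-- The element `∏_{i = 1, 2} δ^{2i}(a_{2i}^+) a_{2i}^-` of `L`, which is the product of the
elements `δ^{2i} a_{2i}^+ (δ^{2i})⁻¹ a_{2i}^-` of `ℒ`. -/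
def levelTwoProd (n : ℕ) : Frac n :=
  ∏ i ∈ Finset.Icc 1 2, (dl n 2 i • aPlus n 2 i) * aMinus n 2 i

lemma ofFrac_levelTwoProd_mem {n : ℕ} (hn : 3 ≤ n) : ofFrac n (levelTwoProd n) ∈ Agl n := by
  have h : ∀ i ∈ Finset.Icc 1 2, ofFrac n ((dl n 2 i • aPlus n 2 i) * aMinus n 2 i) ∈ Agl n := by
    intro i hi
    have := mul_mem (summands_mem_Agl hn hi).1 (summands_mem_Agl hn hi).2
    rwa [ofShift_mul_ofFrac, ofShift_mul_ofFrac, SkewMonoidAlgebra.single_mul_single,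
      smul_inv_smul, mul_inv_cancel, ← ofFrac_apply] at this
  have h12 : (Finset.Icc 1 2 : Finset ℕ) = {1, 2} := by decide
  rw [levelTwoProd, h12, Finset.prod_pair (by decide), map_mul]
  exact mul_mem (h 1 (by decide)) (h 2 (by decide))

lemma symFrac_levelTwoProd {n : ℕ} (g : SymProd n) :
    symFrac n g (levelTwoProd n) = levelTwoProd n := by
  simp only [levelTwoProd, map_prod, map_mul, symFrac_smul, conjShift_dl, symFrac_aPlus,
    symFrac_aMinus]
  exact prod_permN g 2 fun i => (dl n 2 i • aPlus n 2 i) * aMinus n 2 i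

lemma levelTwoProd_eq {n : ℕ} (hn : 3 ≤ n) : levelTwoProd n =
    (∏ i ∈ Finset.Icc 1 3, (x n 3 i - x n 2 1 + 1)) / (x n 2 2 - x n 2 1 + 1) *
    ((x n 1 1 - x n 2 1) / (x n 2 2 - x n 2 1)) *
    ((∏ i ∈ Finset.Icc 1 3, (x n 3 i - x n 2 2 + 1)) / (x n 2 1 - x n 2 2 + 1)) *
    ((x n 1 1 - x n 2 2) / (x n 2 1 - x n 2 2)) := by
  have h12 : (Finset.Icc 1 2 : Finset ℕ) = {1, 2} := by decide
  have hP : ∀ i j : ℕ, (1 ≤ i ∧ i ≤ 2) → j ≠ i → (Finset.Icc 1 2).erase i = {j} →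
      dl n 2 i • aPlus n 2 i =
        -((∏ l ∈ Finset.Icc 1 3, (x n 3 l - x n 2 i + 1)) / (x n 2 j - x n 2 i + 1)) := by
    intro i j hi hji he
    rw [aPlus, he, Finset.prod_singleton, smul_neg, smul_div₀', Finset.smul_prod', smul_sub,
      dl_smul_x_self (by omega), dl_smul_x_of_ne (by omega), sub_sub_eq_add_sub, add_sub_right_comm]
    congr 2
    refine Finset.prod_congr rfl fun l _ => ?_
    rw [smul_sub, dl_smul_x_self (by omega), dl_smul_x_of_ne (by omega), sub_sub_eq_add_sub,
      add_sub_right_comm]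
  have hM : ∀ i j : ℕ, (Finset.Icc 1 2).erase i = {j} →
      aMinus n 2 i = (x n 1 1 - x n 2 i) / (x n 2 j - x n 2 i) := by
    intro i j he
    rw [aMinus, he, Finset.prod_singleton]
    simp
  rw [levelTwoProd, h12, Finset.prod_pair (by decide),
    hP 1 2 (by omega) (by omega) Icc_one_two_erase_one, hM 1 2 Icc_one_two_erase_one,
    hP 2 1 (by omega) (by omega) Icc_one_two_erase_two, hM 2 1 Icc_one_two_erase_two]
  ring

/-- The function is not a polynomial: its denominator vanishes where `x_{22} = x_{21} - 1`, and its
numerator does not. -/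
lemma levelTwoProd_notMem {n : ℕ} (hn : 3 ≤ n) :
    levelTwoProd n ∉ Set.range (algebraMap (Lam n) (Frac n)) := by
  rintro ⟨G, hG⟩
  rw [levelTwoProd_eq hn] at hG
  have hinj := IsFractionRing.injective (Lam n) (Frac n)
  have hx : ∀ {k i : ℕ} (h : 1 ≤ i ∧ i ≤ k ∧ k ≤ n),
      x n k i = algebraMap (Lam n) (Frac n) (MvPolynomial.X (mkIdx n k i h)) :=
    fun h => dif_pos h
  rw [hx (k := 2) (i := 1) (by omega), hx (k := 2) (i := 2) (by omega),
    hx (k := 1) (i := 1) (by omega)] at hG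
  have h123 : (Finset.Icc 1 3 : Finset ℕ) = {1, 2, 3} := by decide
  simp only [h123, Finset.prod_insert (show (1 : ℕ) ∉ ({2, 3} : Finset ℕ) by decide),
    Finset.prod_pair (show (2 : ℕ) ≠ 3 by decide)] at hG
  rw [hx (k := 3) (i := 1) (by omega), hx (k := 3) (i := 2) (by omega),
    hx (k := 3) (i := 3) (by omega)] at hG
  simp only [← map_sub, ← map_mul, ← map_one (algebraMap (Lam n) (Frac n)), ← map_add] at hG
  simp only [div_mul_div_comm, ← map_mul] at hG
  rw [eq_div_iff, ← map_mul] at hG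
  -- the point `x_{21} = 1`, `x_{22} = 0`, all other coordinates `5`
  · have := congrArg (MvPolynomial.aeval fun p : Idx n =>
      if (p.1 : ℕ) = 2 then (if (p.2 : ℕ) = 1 then (1 : ℂ) else 0) else 5) (hinj hG)
    simp [mkIdx] at this
    norm_num at this
  -- the denominator is not the zero polynomial, as its value at `x_{21} = 2`, `x_{22} = 0` shows
  · rw [Ne, map_eq_zero_iff _ hinj]
    intro h
    have := congrArg (MvPolynomial.aeval fun p : Idx n =>
      if (p.1 : ℕ) = 2 then (if (p.2 : ℕ) = 1 then (2 : ℂ) else 0) else 0) h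
    simp [mkIdx] at this
    norm_num at this

/-! ### Integrality in Galois orders -/

/-- If `A` is a left Galois `Λ^H`-order, then the elements of `A ∩ L^H` are integral over `Λ`. The
order condition is applied to the one-dimensional space `L^H`, and the finite generation is carried
over to `L` by taking the coefficient at the trivial shift. -/
lemma isIntegral_of_isLeftGaloisOrder {n : ℕ} {H : Subgroup (SymProd n)}
    {A : Subalgebra ℂ (SkewRing n)}
    (hA : IsLeftGaloisOrder (invLam n H).toSubring (invFrac n H).toSubring
      (invSkew n H).toSubring A.toSubring)
    {a : Frac n} (ha : ∀ g ∈ H, symFrac n g a = a) (haA : ofFrac n a ∈ A) :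
    IsIntegral (Lam n) a := by
  set K := (invFrac n H).toSubring
  have hmemW : ∀ u : SkewRing n,
      u ∈ Submodule.span K ({1} : Set (SkewRing n)) ↔ u ∈ invFrac n H := by
    intro u
    rw [Submodule.mem_span_singleton]
    constructor
    · rintro ⟨⟨c, hc⟩, rfl⟩
      rw [Subring.smul_def, smul_eq_mul, mul_one]
      exact hc
    · intro hu
      exact ⟨⟨u, hu⟩, by rw [Subring.smul_def, smul_eq_mul, mul_one]⟩
  obtain ⟨t, ht⟩ := hA.left_fg (Submodule.span K {1}) (Submodule.fg_span_singleton _) (by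
    intro u hu
    obtain ⟨b, hb, rfl⟩ := mem_invFrac.1 ((hmemW u).1 hu)
    refine mem_invSkew.2 fun g hg => ?_
    rw [symSkew_ofFrac, hb g hg])
  classical
  let T : Finset (Frac n) := t.image fun u => u.coeff 1
  have hT : ∀ u ∈ Submodule.span (invLam n H).toSubring (t : Set (SkewRing n)),
      u.coeff 1 ∈ Submodule.span (Lam n) (T : Set (Frac n)) := by
    intro u hu
    induction hu using Submodule.span_induction with
    | mem u hu => exact Submodule.subset_span (Finset.mem_coe.2 (Finset.mem_image_of_mem _ hu))
    | zero => simp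
    | add u v _ _ hu hv =>
      rw [SkewMonoidAlgebra.coeff_add]
      exact add_mem hu hv
    | smul c u _ hu =>
      obtain ⟨f, -, hf⟩ := mem_invLam.1 c.2
      have : (c • u).coeff 1 = f • u.coeff 1 := by
        rw [Subring.smul_def, smul_eq_mul]
        change ((c : SkewRing n) * u).coeff 1 = _
        rw [← hf, ofFrac_apply, SkewMonoidAlgebra.coeff_single_one_mul, Algebra.smul_def]
      rw [this]
      exact Submodule.smul_mem _ _ hu
  have hpow : ∀ m : ℕ, a ^ m ∈ Submodule.span (Lam n) (T : Set (Frac n)) := by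
    intro m
    have hm : ofFrac n (a ^ m) ∈
        Submodule.span (invLam n H).toSubring (t : Set (SkewRing n)) := by
      rw [← SetLike.mem_coe, ht]
      refine ⟨(hmemW _).2 (mem_invFrac.2 ⟨a ^ m, fun g hg => ?_, rfl⟩), ?_⟩
      · rw [map_pow, ha g hg]
      · rw [map_pow]
        exact pow_mem haA m
    have := hT _ hm
    rwa [ofFrac_apply, SkewMonoidAlgebra.coeff_single, Finsupp.single_eq_same] at this
  have hle : Subalgebra.toSubmodule (Algebra.adjoin (Lam n) {a}) ≤
      Submodule.span (Lam n) (T : Set (Frac n)) := by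
    rw [Algebra.adjoin_singleton_eq_range_aeval]
    rintro _ ⟨p, rfl⟩
    change Polynomial.aeval a p ∈ _
    rw [Polynomial.aeval_eq_sum_range]
    exact sum_mem fun m _ => Submodule.smul_mem _ _ (hpow m)
  exact IsIntegral.of_mem_of_fg _
    (Submodule.FG.of_le (Submodule.fg_span T.finite_toSet) hle) a
    (Algebra.self_mem_adjoin_singleton _ _)

end

end AltExt

theorem proposition4p3 :
    (∀ n : ℕ, 3 ≤ n → AltExt.Ugl n < AltExt.Agl n ⊓ AltExt.invSkew n ⊤) ∧
    (AltExt.ofFrac 3 AltExt.specialElt ∈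
        (AltExt.Agl 3 ⊓ AltExt.invSkew 3 ⊤) ⊓ AltExt.invFrac 3 ⊤ ∧
      AltExt.specialElt ∉ Set.range (algebraMap (AltExt.Lam 3) (AltExt.Frac 3)) ∧
      AltExt.ofFrac 3 AltExt.specialElt ∉ AltExt.invLam 3 ⊤) ∧
    (∀ n : ℕ, 3 ≤ n →
      ¬ AltExt.IsGaloisOrder
          (AltExt.invLam n (AltExt.altProd n)).toSubring
          (AltExt.invFrac n (AltExt.altProd n)).toSubring
          (AltExt.invSkew n (AltExt.altProd n)).toSubring
          (AltExt.Agl n).toSubring) := by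
  have hinv : ∀ n, AltExt.ofFrac n (AltExt.levelTwoProd n) ∈ AltExt.invSkew n ⊤ := fun n =>
    AltExt.mem_invSkew.2 fun g _ => by rw [AltExt.symSkew_ofFrac, AltExt.symFrac_levelTwoProd]
  refine ⟨fun n hn => lt_of_le_of_ne
    (le_inf (AltExt.Ugl_le_Agl n) (AltExt.Ugl_le_invSkew n)) fun h => ?_, ?_, fun n hn h => ?_⟩
  · refine AltExt.levelTwoProd_notMem hn (AltExt.mem_range_of_ofFrac_mem_Ugl ?_)
    rw [h]
    exact ⟨AltExt.ofFrac_levelTwoProd_mem hn, hinv n⟩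
  · have he : AltExt.specialElt = AltExt.levelTwoProd 3 :=
      (AltExt.levelTwoProd_eq le_rfl).symm
    rw [he]
    refine ⟨⟨⟨AltExt.ofFrac_levelTwoProd_mem le_rfl, hinv 3⟩, AltExt.mem_invFrac.2
      ⟨_, fun g _ => AltExt.symFrac_levelTwoProd g, rfl⟩⟩,
      AltExt.levelTwoProd_notMem le_rfl, fun h => ?_⟩
    obtain ⟨f, -, hf⟩ := AltExt.mem_invLam.1 h
    exact AltExt.levelTwoProd_notMem le_rfl ⟨f, SkewMonoidAlgebra.single_injective 1 hf⟩
  · exact AltExt.levelTwoProd_notMem hn (IsIntegrallyClosed.isIntegral_iff.1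
      (AltExt.isIntegral_of_isLeftGaloisOrder h.1 (fun g _ => AltExt.symFrac_levelTwoProd g)
        (AltExt.ofFrac_levelTwoProd_mem hn)))
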